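/- Let $d\ge 2$ and $n\ge 0$ be integers with $n<\frac d3$. Let $B_d$ be the closed Euclidean unit ball of $\mathbb R^d$, let $e_1,\dots,e_d$ be the standard basis and $E=\mathrm{span}\{e_1,e_2\}$. For a symmetric positive semidefinite (possibly singular) $d\times d$ real matrix $A$, let $A^{1/2}$ be its positive semidefinite square root, and let $C_E(A)$ be the $2\times 2$ covariance matrix, in the coordinates $x_1,x_2$ of $E$, of the uniform distribution on the (possibly degenerate) ellipse $A^{1/2}B_d\cap E$. Here, if the ellipse has dimension $k\in\{0,1,2\}$, its uniform distribution is the normalized $k$-dimensional volume on it (a Dirac mass if $k=0$). Let $X_1,\dots,X_n$ be independent standard Gaussian random vectors in $\mathbb R^d$. Then there does not exist a (Borel measurable) function $F:(\mathbb R^d)^n\to\{0,1,2\}$ such that for every symmetric positive semidefinite $d\times d$ real matrix $A$ one has $$\mathbb P\left(F(A^{1/2}X_1,\dots,A^{1/2}X_n)=\mathrm{rank}(C_E(A))\right)>0.9 .$$ -/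

import Mathlib

open MeasureTheory ProbabilityTheory
open scoped MatrixOrder

noncomputable section

/-- The linear map `x ↦ A^{1/2} x` of Euclidean space `ℝ^d`, where `A^{1/2}` is the positive
semidefinite square root of the positive semidefinite matrix `A`. -/
def sqrtMap {d : ℕ} (A : Matrix (Fin d) (Fin d) ℝ) :
    EuclideanSpace ℝ (Fin d) →L[ℝ] EuclideanSpace ℝ (Fin d) :=
  Matrix.toEuclideanCLM (n := Fin d) (𝕜 := ℝ) (CFC.sqrt A)

/-- The plane `E = span {e₁, e₂}` in `ℝ^d`, for `2 ≤ d`. -/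
def planeE {d : ℕ} (hd : 2 ≤ d) : Submodule ℝ (EuclideanSpace ℝ (Fin d)) :=
  Submodule.span ℝ
    (Set.range fun i : Fin 2 => EuclideanSpace.single (Fin.castLE hd i) (1 : ℝ))

/-- The (possibly degenerate) ellipse `A^{1/2} B_d ∩ E`, with `B_d` the closed Euclidean
unit ball. -/
def ellipseE {d : ℕ} (hd : 2 ≤ d) (A : Matrix (Fin d) (Fin d) ℝ) :
    Set (EuclideanSpace ℝ (Fin d)) :=
  sqrtMap A '' Metric.closedBall 0 1 ∩ (planeE hd : Set (EuclideanSpace ℝ (Fin d)))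

/-- The uniform distribution on a bounded convex set `S` of `ℝ^d`: normalized `k`-dimensional
volume on `S`, where `k` is the dimension of the affine hull of `S`. For `k = 0` the volume is
counting measure, so that the uniform distribution on a point is the Dirac mass. -/
def uniformOnConvex {d : ℕ} (S : Set (EuclideanSpace ℝ (Fin d))) :
    Measure (EuclideanSpace ℝ (Fin d)) :=
  ProbabilityTheory.cond
    (Measure.euclideanHausdorffMeasure (Module.finrank ℝ (vectorSpan ℝ S))) S

/-- `C_E(A)`: the `2 × 2` covariance matrix, in the coordinates of `E` with respect to
`e₁, e₂`, of the uniform distribution on the ellipse `A^{1/2} B_d ∩ E`. -/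
def covE {d : ℕ} (hd : 2 ≤ d) (A : Matrix (Fin d) (Fin d) ℝ) : Matrix (Fin 2) (Fin 2) ℝ :=
  Matrix.of fun i j =>
    ProbabilityTheory.covariance
      (fun x : EuclideanSpace ℝ (Fin d) => x (Fin.castLE hd i))
      (fun x : EuclideanSpace ℝ (Fin d) => x (Fin.castLE hd j))
      (uniformOnConvex (ellipseE hd A))

end

/-!
The obstruction is that `n` samples cannot distinguish an exact linear relation between the
coordinates from the same relation perturbed by small noise, as long as the relation has enough
unknown coefficients.

For weights `w` and a noise level `ε`, let `B_{w,ε}` send `x` to the vector with first coordinate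
`ε x₁ + ∑_{j ≥ 3} w_j x_j`, second coordinate `0`, and `j`-th coordinate `x_j` for `j ≥ 3`, and put
`A_{w,ε} = B_{w,ε} B_{w,ε}ᵀ`. The range of `A_{w,0}^{1/2}` meets `E` in `0` only, so the
covariance matrix of the ellipse has rank `0` (`rank_covE_modelCov_zero`). For `ε > 0` the ellipse
is a nondegenerate segment of `ℝ e₁`, and the rank is not `0` (`rank_covE_modelCov_ne_zero`).

The samples `A_{w,ε}^{1/2} X_i` have the same joint law as `B_{w,ε} X_i`
(`measure_sqrtMap_modelCov`). Since `n ≤ d - 2`, almost surely the equations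
`∑_{j ≥ 3} h_j (X_i)_j = (X_i)₁`, `i = 1, …, n`, have a solution `h = h(X)`
(`ae_det_sampleBlock_ne_zero`, `noiseShift`), and then `B_{w,ε} X_i = B_{w + ε h, 0} X_i` for all
`i`: the noise is absorbed into the weights. When `w` is uniform in the unit ball, the
translation by `ε h` becomes invisible as `ε → 0`, so that no `F` can take the value `0` with
probability at least `0.9` for all `A_{w,0}`, and with probability at most `0.1` for all
`A_{w,ε}` with `ε > 0` (`not_separated_of_small_translation`).
-/

/-! ### Gaussian samples -/

theorem pi_fin_absolutelyContinuous {X : Type*} [MeasurableSpace X] {μ ν : Measure X}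
    [SigmaFinite μ] [SigmaFinite ν] (h : μ ≪ ν) (n : ℕ) :
    Measure.pi (fun _ : Fin n => μ) ≪ Measure.pi (fun _ : Fin n => ν) := by
  induction n with
  | zero =>
    rw [Measure.pi_of_empty (fun _ : Fin 0 => μ), Measure.pi_of_empty (fun _ : Fin 0 => ν)]
  | succ n ih =>
    have hμ := (measurePreserving_piFinSuccAbove (fun _ : Fin (n + 1) => μ) 0).symm
    have hν := (measurePreserving_piFinSuccAbove (fun _ : Fin (n + 1) => ν) 0).symm
    rw [← hμ.map_eq, ← hν.map_eq]
    exact (h.prod ih).map (MeasurableEquiv.measurable _)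

theorem stdGaussian_absolutelyContinuous (d : ℕ) :
    stdGaussian (EuclideanSpace ℝ (Fin d)) ≪ volume := by
  rw [← map_pi_eq_stdGaussian, ← (PiLp.volume_preserving_toLp (Fin d)).map_eq]
  exact (pi_fin_absolutelyContinuous
    (gaussianReal_absolutelyContinuous 0 one_ne_zero) d).map (by fun_prop)

/-- The law of `T G`, for a standard Gaussian `G` and a linear map `T`, depends only on `T Tᵀ`. -/
theorem map_sqrtMap_stdGaussian {d : ℕ} (B : Matrix (Fin d) (Fin d) ℝ) :
    (stdGaussian (EuclideanSpace ℝ (Fin d))).map (sqrtMap (B * B.transpose)) =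
      (stdGaussian (EuclideanSpace ℝ (Fin d))).map
        (Matrix.toEuclideanCLM (n := Fin d) (𝕜 := ℝ) B) := by
  have hpsd : (B * B.transpose).PosSemidef := by
    simpa using Matrix.posSemidef_self_mul_conjTranspose B
  have h1 : (stdGaussian (EuclideanSpace ℝ (Fin d))).map (sqrtMap (B * B.transpose)) =
      multivariateGaussian 0 (B * B.transpose) := by
    simp [multivariateGaussian, sqrtMap]
  rw [h1]
  apply Measure.ext_of_charFunDual
  ext L
  obtain ⟨t, rfl⟩ := (InnerProductSpace.toDual ℝ (EuclideanSpace ℝ (Fin d))).surjective L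
  rw [charFunDual_map, charFunDual_stdGaussian]
  have h2 : ‖(InnerProductSpace.toDual ℝ (EuclideanSpace ℝ (Fin d)) t).comp
      (Matrix.toEuclideanCLM (n := Fin d) (𝕜 := ℝ) B)‖ =
      ‖Matrix.toEuclideanCLM (n := Fin d) (𝕜 := ℝ) B.transpose t‖ := by
    rw [← LinearIsometryEquiv.norm_map (InnerProductSpace.toDual ℝ (EuclideanSpace ℝ (Fin d)))
      (Matrix.toEuclideanCLM (n := Fin d) (𝕜 := ℝ) B.transpose t)]
    congr 1
    ext x
    have : Matrix.toEuclideanCLM (n := Fin d) (𝕜 := ℝ) B.transpose =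
        star (Matrix.toEuclideanCLM (n := Fin d) (𝕜 := ℝ) B) := by
      rw [← map_star, Matrix.star_eq_conjTranspose, Matrix.conjTranspose_eq_transpose_of_trivial]
    simp [this, ContinuousLinearMap.star_eq_adjoint, ContinuousLinearMap.adjoint_inner_left]
  have h3 : charFunDual (multivariateGaussian 0 (B * B.transpose))
      (InnerProductSpace.toDual ℝ (EuclideanSpace ℝ (Fin d)) t) =
      charFun (multivariateGaussian 0 (B * B.transpose)) t := by
    simp [charFun_eq_charFunDual_toDualMap, InnerProductSpace.toDual]
  rw [h2, h3, charFun_multivariateGaussian hpsd, ← Complex.ofReal_pow,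
    EuclideanSpace.real_norm_sq_eq]
  have h4 : t.ofLp ⬝ᵥ (B * B.transpose).mulVec t.ofLp =
      ∑ i, (Matrix.toEuclideanCLM (n := Fin d) (𝕜 := ℝ) B.transpose t) i ^ 2 := by
    rw [← Matrix.mulVec_mulVec, Matrix.dotProduct_mulVec, ← Matrix.mulVec_transpose]
    simp [dotProduct, sq, Matrix.ofLp_toEuclideanCLM]
  rw [h4]
  simp [neg_div]

/-- The square block of the sample matrix formed by the coordinates `σ k` of the samples. -/
def sampleBlock {n d : ℕ} (σ : Fin n → Fin d) (x : Fin n → EuclideanSpace ℝ (Fin d)) :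
    Matrix (Fin n) (Fin n) ℝ :=
  Matrix.of fun i k => x i (σ k)

theorem continuous_sampleBlock {n d : ℕ} (σ : Fin n → Fin d) :
    Continuous (sampleBlock σ) := by
  refine continuous_matrix fun i k => ?_
  simp only [sampleBlock, Matrix.of_apply]
  fun_prop

/-- Translating the samples by `t` times suitable basis vectors adds `t • 1` to the block, and
`det (N + t • 1)` vanishes for finitely many `t` only; hence the singular blocks are a null set. -/
theorem ae_det_sampleBlock_ne_zero {n d : ℕ} {σ : Fin n → Fin d} (hσ : Function.Injective σ) :
    ∀ᵐ x ∂Measure.pi (fun _ : Fin n => stdGaussian (EuclideanSpace ℝ (Fin d))),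
      (sampleBlock σ x).det ≠ 0 := by
  refine (pi_fin_absolutelyContinuous (stdGaussian_absolutelyContinuous d) n).ae_le ?_
  let L : ℝ →ₗ[ℝ] (Fin n → EuclideanSpace ℝ (Fin d)) :=
    LinearMap.toSpanSingleton ℝ _ (fun k => EuclideanSpace.single (σ k) (1 : ℝ))
  refine ae_mem_of_ae_add_linearMap_mem (s := {x | (sampleBlock σ x).det ≠ 0}) L
    (volume : Measure ℝ) (Measure.pi fun _ : Fin n => (volume : Measure (EuclideanSpace ℝ (Fin d))))
    ?_ fun y => ?_
  · exact (isOpen_ne_fun (continuous_sampleBlock σ).matrix_det continuous_const).measurableSet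
  · have hL : ∀ t : ℝ, sampleBlock σ (y + L t) = Matrix.scalar (Fin n) t - -(sampleBlock σ y) := by
      intro t
      ext i k
      have : (σ k = σ i) = (i = k) := by
        rw [hσ.eq_iff]; exact propext eq_comm
      simp [sampleBlock, L, Matrix.diagonal_apply, this, add_comm]
    have hfin : {t : ℝ | ¬ (sampleBlock σ (y + L t)).det ≠ 0}.Finite := by
      refine ((-(sampleBlock σ y)).charpoly.roots.toFinset.finite_toSet).subset fun t ht => ?_
      have ht' : (sampleBlock σ (y + L t)).det = 0 := by simpa using ht
      rw [hL, ← Matrix.eval_charpoly] at ht'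
      simpa [Polynomial.mem_roots, (Matrix.charpoly_monic (-(sampleBlock σ y))).ne_zero] using ht'
    exact hfin.measure_zero _

/-! ### The square root of a matrix -/

theorem sqrtMap_sqrtMap {d : ℕ} {A : Matrix (Fin d) (Fin d) ℝ} (hA : A.PosSemidef)
    (v : EuclideanSpace ℝ (Fin d)) :
    sqrtMap A (sqrtMap A v) = Matrix.toEuclideanCLM (n := Fin d) (𝕜 := ℝ) A v := by
  rw [sqrtMap, ← mul_apply_eq_comp, ← map_mul, CFC.sqrt_mul_sqrt_self A hA.nonneg]

theorem inner_sqrtMap_left {d : ℕ} (A : Matrix (Fin d) (Fin d) ℝ)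
    (x y : EuclideanSpace ℝ (Fin d)) :
    inner ℝ (sqrtMap A x) y = inner ℝ x (sqrtMap A y) := by
  have h : IsSelfAdjoint (sqrtMap A) := (CFC.sqrt_nonneg A).isSelfAdjoint.map _
  rw [← ContinuousLinearMap.adjoint_inner_left, h.adjoint_eq]

theorem sqrtMap_eq_zero {d : ℕ} {A : Matrix (Fin d) (Fin d) ℝ} (hA : A.PosSemidef)
    {v : EuclideanSpace ℝ (Fin d)} (hv : A.mulVec v.ofLp = 0) : sqrtMap A v = 0 := by
  rw [← inner_self_eq_zero (𝕜 := ℝ), inner_sqrtMap_left, sqrtMap_sqrtMap hA]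
  have : Matrix.toEuclideanCLM (n := Fin d) (𝕜 := ℝ) A v = 0 := by
    ext i; simp [Matrix.ofLp_toEuclideanCLM, hv]
  rw [this, inner_zero_right]

/-! ### The covariance models -/

/-- The matrix `B_{w,ε}` sending `x` to the vector with first coordinate
`ε x₁ + ∑_{j ≥ 3} w_j x_j`, second coordinate `0`, and `j`-th coordinate `x_j` for `j ≥ 3`.
The first two entries of `w` play no role. -/
def loadingMatrix {d : ℕ} (hd : 2 ≤ d) (w : Fin d → ℝ) (ε : ℝ) : Matrix (Fin d) (Fin d) ℝ :=
  Matrix.of fun i j =>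
    if i = Fin.castLE hd 0 then
      if j = Fin.castLE hd 0 then ε else if j = Fin.castLE hd 1 then 0 else w j
    else if i = Fin.castLE hd 1 then 0
    else if i = j then 1 else 0

/-- The covariance matrix `B_{w,ε} B_{w,ε}ᵀ`. -/
def modelCov {d : ℕ} (hd : 2 ≤ d) (w : Fin d → ℝ) (ε : ℝ) : Matrix (Fin d) (Fin d) ℝ :=
  loadingMatrix hd w ε * (loadingMatrix hd w ε).transpose

/-- The vector `e₁ - ∑_{j ≥ 3} w_j e_j`, orthogonal to the range of `B_{w,0}`. -/
def conormal {d : ℕ} (hd : 2 ≤ d) (w : Fin d → ℝ) : EuclideanSpace ℝ (Fin d) :=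
  WithLp.toLp 2 fun j =>
    if j = Fin.castLE hd 0 then 1 else if j = Fin.castLE hd 1 then 0 else -w j

theorem castLE_zero_ne_one {d : ℕ} (hd : 2 ≤ d) : Fin.castLE hd 0 ≠ Fin.castLE hd 1 := by
  simp [Fin.ext_iff]

theorem posSemidef_modelCov {d : ℕ} (hd : 2 ≤ d) (w : Fin d → ℝ) (ε : ℝ) :
    (modelCov hd w ε).PosSemidef := by
  simpa [modelCov] using Matrix.posSemidef_self_mul_conjTranspose (loadingMatrix hd w ε)

/-- At `ε = 0` the conormal vector lies in the kernel of `A_{w,ε}`; for `ε > 0` the identity puts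
`e₁` into the range of `A_{w,ε}`. -/
theorem modelCov_mulVec_conormal {d : ℕ} (hd : 2 ≤ d) (w : Fin d → ℝ) (ε : ℝ) :
    (modelCov hd w ε).mulVec (conormal hd w).ofLp = Pi.single (Fin.castLE hd 0) (ε ^ 2) := by
  have h01 := castLE_zero_ne_one hd
  have h1 : (loadingMatrix hd w ε).transpose.mulVec (conormal hd w).ofLp =
      Pi.single (Fin.castLE hd 0) ε := by
    ext j
    have : ∀ i, (loadingMatrix hd w ε).transpose j i * (conormal hd w).ofLp i =
        (if i = Fin.castLE hd 0 then
          if j = Fin.castLE hd 0 then ε else if j = Fin.castLE hd 1 then 0 else w j else 0) +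
        (if i = j then
          if j = Fin.castLE hd 0 then 0 else if j = Fin.castLE hd 1 then 0 else -w j else 0) := by
      intro i
      simp only [Matrix.transpose_apply, loadingMatrix, Matrix.of_apply, conormal]
      split_ifs <;> simp_all
    simp only [Matrix.mulVec, dotProduct, this, Finset.sum_add_distrib, Finset.sum_ite_eq',
      Finset.mem_univ, if_true, Pi.single_apply]
    split_ifs <;> simp
  rw [modelCov, ← Matrix.mulVec_mulVec, h1]
  ext i
  simp only [Matrix.mulVec_single, loadingMatrix, Pi.single_apply]
  by_cases hi : i = Fin.castLE hd 0
  · simp [hi, sq]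
  · simp [hi]

theorem modelCov_mulVec_single_one {d : ℕ} (hd : 2 ≤ d) (w : Fin d → ℝ) (ε : ℝ) :
    (modelCov hd w ε).mulVec
      (EuclideanSpace.single (Fin.castLE hd 1) (1 : ℝ)).ofLp = 0 := by
  have h01 := castLE_zero_ne_one hd
  have h1 : (loadingMatrix hd w ε).transpose.mulVec
      (EuclideanSpace.single (Fin.castLE hd 1) (1 : ℝ)).ofLp = 0 := by
    ext j
    simp [loadingMatrix, h01.symm]
  rw [modelCov, ← Matrix.mulVec_mulVec, h1, Matrix.mulVec_zero]

/-- If `h` solves `∑_{j ≥ 3} h_j x_j = x₁`, then the noise `ε x₁` amounts to changing the weights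
from `w` to `w + ε h`. -/
theorem loadingMatrix_apply_eq {d : ℕ} (hd : 2 ≤ d) (w h : Fin d → ℝ) (ε : ℝ)
    (x : EuclideanSpace ℝ (Fin d))
    (hx : ∑ j, (if j = Fin.castLE hd 0 ∨ j = Fin.castLE hd 1 then 0 else h j) * x j =
      x (Fin.castLE hd 0)) :
    Matrix.toEuclideanCLM (n := Fin d) (𝕜 := ℝ) (loadingMatrix hd w ε) x =
      Matrix.toEuclideanCLM (n := Fin d) (𝕜 := ℝ) (loadingMatrix hd (w + ε • h) 0) x := by
  have h01 := castLE_zero_ne_one hd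
  ext i
  simp only [Matrix.ofLp_toEuclideanCLM, Matrix.mulVec, dotProduct]
  by_cases hi : i = Fin.castLE hd 0
  · have : ∀ j, loadingMatrix hd w ε i j * x j = loadingMatrix hd (w + ε • h) 0 i j * x j +
        ((if j = Fin.castLE hd 0 then ε * x j else 0) -
          ε * ((if j = Fin.castLE hd 0 ∨ j = Fin.castLE hd 1 then 0 else h j) * x j)) := by
      intro j
      simp only [loadingMatrix, Matrix.of_apply, hi, if_true, Pi.add_apply, Pi.smul_apply,
        smul_eq_mul]
      split_ifs <;> simp_all
      ring
    simp only [this, Finset.sum_add_distrib, Finset.sum_sub_distrib, ← Finset.mul_sum, hx,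
      Finset.sum_ite_eq', Finset.mem_univ, if_true]
    ring
  · simp [loadingMatrix, hi]

/-! ### The ellipses of the models -/

theorem apply_eq_zero_of_mem_planeE {d : ℕ} (hd : 2 ≤ d) {y : EuclideanSpace ℝ (Fin d)}
    (hy : y ∈ planeE hd) {j : Fin d} (h0 : j ≠ Fin.castLE hd 0) (h1 : j ≠ Fin.castLE hd 1) :
    y j = 0 := by
  induction hy using Submodule.span_induction with
  | mem x hx =>
    obtain ⟨i, rfl⟩ := hx
    fin_cases i
    · simpa using h0
    · simpa using h1
  | zero => rfl
  | add x y _ _ hx hy => simp [hx, hy]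
  | smul a x _ hx => simp [hx]

theorem single_mem_planeE {d : ℕ} (hd : 2 ≤ d) (c : ℝ) :
    EuclideanSpace.single (Fin.castLE hd 0) c ∈ planeE hd := by
  have : EuclideanSpace.single (Fin.castLE hd 0) c =
      c • EuclideanSpace.single (Fin.castLE hd 0) (1 : ℝ) := by ext; simp
  rw [this]
  exact Submodule.smul_mem _ _ (Submodule.subset_span ⟨0, rfl⟩)

/-- Every point of the range of `A^{1/2}` is orthogonal to `e₂ ∈ ker A`, so the ellipse lies in
`ℝ e₁`. -/
theorem eq_single_of_mem_ellipseE_modelCov {d : ℕ} (hd : 2 ≤ d) (w : Fin d → ℝ) (ε : ℝ)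
    {y : EuclideanSpace ℝ (Fin d)} (hy : y ∈ ellipseE hd (modelCov hd w ε)) :
    y = EuclideanSpace.single (Fin.castLE hd 0) (y (Fin.castLE hd 0)) := by
  have h01 := castLE_zero_ne_one hd
  obtain ⟨⟨x, -, rfl⟩, hE⟩ := hy
  ext j
  by_cases h0 : j = Fin.castLE hd 0
  · simp [h0]
  by_cases h1 : j = Fin.castLE hd 1
  · have h := inner_sqrtMap_left (modelCov hd w ε) x (EuclideanSpace.single (Fin.castLE hd 1) 1)
    rw [sqrtMap_eq_zero (posSemidef_modelCov hd w ε) (modelCov_mulVec_single_one hd w ε),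
      inner_zero_right, EuclideanSpace.inner_single_right] at h
    subst h1
    simpa [h01.symm] using h
  · simp [apply_eq_zero_of_mem_planeE hd hE h0 h1, h0]

/-- At `ε = 0` the range of `A^{1/2}` is orthogonal to the conormal vector, whose `e₁`-component
is `1`. -/
theorem ellipseE_modelCov_zero {d : ℕ} (hd : 2 ≤ d) (w : Fin d → ℝ)
    {y : EuclideanSpace ℝ (Fin d)} (hy : y ∈ ellipseE hd (modelCov hd w 0)) : y = 0 := by
  have hs := eq_single_of_mem_ellipseE_modelCov hd w 0 hy
  obtain ⟨⟨x, -, rfl⟩, -⟩ := hy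
  have hA : (modelCov hd w 0).mulVec (conormal hd w).ofLp = 0 := by
    rw [modelCov_mulVec_conormal]; simp
  have h := inner_sqrtMap_left (modelCov hd w 0) x (conormal hd w)
  rw [sqrtMap_eq_zero (posSemidef_modelCov hd w 0) hA, inner_zero_right, hs,
    EuclideanSpace.inner_single_left] at h
  have h0 : sqrtMap (modelCov hd w 0) x (Fin.castLE hd 0) = 0 := by
    simpa [conormal] using h
  rw [hs, h0]
  ext; simp

theorem exists_single_mem_ellipseE_modelCov {d : ℕ} (hd : 2 ≤ d) (w : Fin d → ℝ) {ε : ℝ}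
    (hε : 0 < ε) :
    ∃ c : ℝ, 0 < c ∧
      EuclideanSpace.single (Fin.castLE hd 0) c ∈ ellipseE hd (modelCov hd w ε) := by
  set u := sqrtMap (modelCov hd w ε) (conormal hd w) with hu
  have hpos : 0 < 1 + ‖u‖ := by positivity
  refine ⟨(1 + ‖u‖)⁻¹ * ε ^ 2, by positivity, ⟨(1 + ‖u‖)⁻¹ • u, ?_, ?_⟩, single_mem_planeE hd _⟩
  · rw [mem_closedBall_zero_iff, norm_smul, norm_inv, Real.norm_of_nonneg hpos.le,
      inv_mul_le_iff₀ hpos]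
    linarith
  · rw [map_smul, hu, sqrtMap_sqrtMap (posSemidef_modelCov hd w ε)]
    ext i
    simp [Matrix.ofLp_toEuclideanCLM, modelCov_mulVec_conormal, Pi.single_apply]

theorem convex_ellipseE {d : ℕ} (hd : 2 ≤ d) (A : Matrix (Fin d) (Fin d) ℝ) :
    Convex ℝ (ellipseE hd A) :=
  ((convex_closedBall 0 1).linear_image (sqrtMap A).toLinearMap).inter (planeE hd).convex

theorem isCompact_ellipseE {d : ℕ} (hd : 2 ≤ d) (A : Matrix (Fin d) (Fin d) ℝ) :
    IsCompact (ellipseE hd A) :=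
  ((isCompact_closedBall 0 1).image (sqrtMap A).continuous).inter_right
    (planeE hd).closed_of_finiteDimensional

theorem zero_mem_ellipseE {d : ℕ} (hd : 2 ≤ d) (A : Matrix (Fin d) (Fin d) ℝ) :
    0 ∈ ellipseE hd A :=
  ⟨⟨0, by simp, map_zero _⟩, (planeE hd).zero_mem⟩

/-! ### The rank of the covariance of the uniform distribution -/

theorem covE_eq_zero_of_ellipseE {d : ℕ} (hd : 2 ≤ d) {A : Matrix (Fin d) (Fin d) ℝ}
    (h : ∀ y ∈ ellipseE hd A, y = 0) : covE hd A = 0 := by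
  have hae : ∀ᵐ y ∂uniformOnConvex (ellipseE hd A), y = 0 := by
    filter_upwards [ae_cond_mem (isCompact_ellipseE hd A).measurableSet] with y hy
    exact h y hy
  ext i j
  have hc : ∀ k : Fin 2, (fun x : EuclideanSpace ℝ (Fin d) => x (Fin.castLE hd k))
      =ᵐ[uniformOnConvex (ellipseE hd A)] fun _ => (0 : ℝ) := by
    intro k
    filter_upwards [hae] with y hy
    simp [hy]
  have hz : ∫ x, x (Fin.castLE hd i) ∂uniformOnConvex (ellipseE hd A) = 0 := by
    rw [integral_congr_ae (hc i)]; simp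
  simp only [covE, Matrix.of_apply, covariance, Matrix.zero_apply, hz]
  refine integral_eq_zero_of_ae ?_
  filter_upwards [hc i] with y hy
  simp [hy]

/-- If the ellipse is a nondegenerate segment of `ℝ e₁`, then the first coordinate is not almost
surely constant under its uniform distribution, so its variance does not vanish. -/
theorem covE_apply_zero_zero_ne_zero {d : ℕ} (hd : 2 ≤ d) {A : Matrix (Fin d) (Fin d) ℝ}
    (hline : ∀ y ∈ ellipseE hd A,
      y = EuclideanSpace.single (Fin.castLE hd 0) (y (Fin.castLE hd 0)))
    {c : ℝ} (hc : 0 < c) (hmem : EuclideanSpace.single (Fin.castLE hd 0) c ∈ ellipseE hd A) :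
    covE hd A 0 0 ≠ 0 := by
  set S := ellipseE hd A with hS
  set e : EuclideanSpace ℝ (Fin d) := EuclideanSpace.single (Fin.castLE hd 0) 1 with he
  have hsmul : ∀ t : ℝ, EuclideanSpace.single (Fin.castLE hd 0) t = t • e := by
    intro t; ext; simp [e]
  have hSm : MeasurableSet S := (isCompact_ellipseE hd A).measurableSet
  have hdim : Module.finrank ℝ (vectorSpan ℝ S) = 1 := by
    have : vectorSpan ℝ S = Submodule.span ℝ {e} := by
      refine le_antisymm (Submodule.span_le.2 ?_) ?_
      · rintro _ ⟨x, hx, y, hy, rfl⟩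
        change x - y ∈ Submodule.span ℝ {e}
        rw [hline x hx, hline y hy, hsmul, hsmul, ← sub_smul]
        exact Submodule.smul_mem _ _ (Submodule.mem_span_singleton_self e)
      · rw [Submodule.span_singleton_le_iff_mem]
        have := vsub_mem_vectorSpan ℝ hmem (zero_mem_ellipseE hd A)
        rw [vsub_eq_sub, sub_zero, hsmul] at this
        exact (Submodule.smul_mem_iff _ hc.ne').1 this
    rw [this, finrank_span_singleton]
    simp [e]
  -- The line through the first basis vector is an isometric copy of `ℝ`, on which
  -- one-dimensional volume is Lebesgue measure.
  let ι : ℝ →ₗᵢ[ℝ] EuclideanSpace ℝ (Fin d) :=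
    LinearIsometry.toSpanSingleton ℝ (EuclideanSpace ℝ (Fin d)) (v := e) (by simp [e])
  have hι : ∀ t, ι t = t • e := fun t => rfl
  have hvol : ∀ T ⊆ S, Measure.euclideanHausdorffMeasure 1 T = volume (ι ⁻¹' T) := by
    intro T hT
    have h1 : (Measure.euclideanHausdorffMeasure 1 : Measure ℝ) = volume := by
      simpa using InnerProductSpace.euclideanHausdorffMeasure_eq_volume (V := ℝ)
    have h2 : ι '' (ι ⁻¹' T) = T := by
      refine Set.image_preimage_eq_of_subset fun y hy => ⟨y (Fin.castLE hd 0), ?_⟩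
      rw [hι, ← hsmul, ← hline y (hT hy)]
    conv_lhs => rw [← h2]
    rw [ι.isometry.euclideanHausdorffMeasure_image, h1]
  have hpos : volume (ι ⁻¹' S) ≠ 0 := by
    have hsub : Set.Icc 0 c ⊆ ι ⁻¹' S := by
      intro t ht
      have hconv := (convex_ellipseE hd A).smul_mem_of_zero_mem (zero_mem_ellipseE hd A) hmem
        (t := t / c) ⟨div_nonneg ht.1 hc.le, div_le_one_of_le₀ ht.2 hc.le⟩
      rw [hsmul, smul_smul, div_mul_cancel₀ _ hc.ne'] at hconv
      exact hconv
    intro h0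
    have := measure_mono_null hsub h0
    simp [Real.volume_Icc, hc.not_ge] at this
  have hfin : volume (ι ⁻¹' S) ≠ ⊤ := by
    have := ι.isometry.isClosedEmbedding.isCompact_preimage (isCompact_ellipseE hd A)
    exact this.measure_ne_top
  have hprob : IsProbabilityMeasure (uniformOnConvex S) := by
    rw [uniformOnConvex, hdim]
    exact cond_isProbabilityMeasure_of_finite (by rwa [hvol S subset_rfl])
      (by rwa [hvol S subset_rfl])
  have haeS : ∀ᵐ y ∂uniformOnConvex S, y ∈ S := ae_cond_mem hSm
  have hmeas : Measurable fun x : EuclideanSpace ℝ (Fin d) => x (Fin.castLE hd 0) := by fun_prop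
  have hL2 : MemLp (fun x : EuclideanSpace ℝ (Fin d) => x (Fin.castLE hd 0)) 2
      (uniformOnConvex S) := by
    obtain ⟨C, hC⟩ := (isCompact_ellipseE hd A).isBounded.exists_norm_le
    refine MemLp.of_bound hmeas.aestronglyMeasurable C ?_
    filter_upwards [haeS] with y hy
    exact (PiLp.norm_apply_le y _).trans (hC y hy)
  intro hzero
  have hvar : variance (fun x : EuclideanSpace ℝ (Fin d) => x (Fin.castLE hd 0))
      (uniformOnConvex S) = 0 := by
    rw [← covariance_self hmeas.aemeasurable]
    exact hzero
  have hconst := ae_eq_integral_of_variance_eq_zero hL2 hvar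
  set m := ∫ x, x (Fin.castLE hd 0) ∂uniformOnConvex S
  rw [ae_iff, uniformOnConvex, hdim, cond_apply hSm, mul_eq_zero, ENNReal.inv_eq_zero,
    hvol S subset_rfl, hvol _ Set.inter_subset_left] at hconst
  have hnull := hconst.resolve_left hfin
  refine hpos (measure_mono_null (t := _ ∪ {m}) ?_ (measure_union_null hnull (measure_singleton m)))
  intro t ht
  by_cases htm : t = m
  · exact Or.inr htm
  · refine Or.inl ⟨ht, ?_⟩
    simpa [hι, e] using htm

theorem rank_covE_modelCov_zero {d : ℕ} (hd : 2 ≤ d) (w : Fin d → ℝ) :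
    (covE hd (modelCov hd w 0)).rank = 0 := by
  rw [covE_eq_zero_of_ellipseE hd fun y hy => ellipseE_modelCov_zero hd w hy, Matrix.rank_zero]

theorem rank_covE_modelCov_ne_zero {d : ℕ} (hd : 2 ≤ d) (w : Fin d → ℝ) {ε : ℝ} (hε : 0 < ε) :
    (covE hd (modelCov hd w ε)).rank ≠ 0 := by
  obtain ⟨c, hc, hmem⟩ := exists_single_mem_ellipseE_modelCov hd w hε
  intro h
  refine covE_apply_zero_zero_ne_zero hd
    (fun y hy => eq_single_of_mem_ellipseE_modelCov hd w ε hy) hc hmem ?_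
  rw [Matrix.rank, Submodule.finrank_eq_zero, LinearMap.range_eq_bot] at h
  have h' := congrFun (congrArg (fun f => f (Pi.single 0 1)) h) 0
  simpa using h'

/-! ### Averaging over small translations -/

/-- The average over `w` in the unit ball of the probability that `(w, x) ∈ D` changes
arbitrarily little when `w` is replaced by `w + ε h(x)` and `ε` is small. Hence these
probabilities cannot be separated uniformly in `w` and `ε`. -/
theorem not_separated_of_small_translation {Ξ W : Type*} [MeasurableSpace Ξ]
    [NormedAddCommGroup W] [NormedSpace ℝ W] [FiniteDimensional ℝ W] [MeasurableSpace W]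
    [BorelSpace W] (ν : Measure W) [ν.IsAddHaarMeasure] (Γ : Measure Ξ) [IsProbabilityMeasure Γ]
    {h : Ξ → W} (hh : Measurable h) {D : Set (W × Ξ)} (hD : MeasurableSet D) {p q : ENNReal}
    (hqp : q < p) (hp : ∀ w, p ≤ Γ {x | (w, x) ∈ D})
    (hq : ∀ w, ∀ ε : ℝ, 0 < ε → Γ {x | (w + ε • h x, x) ∈ D} ≤ q) : False := by
  have : ProperSpace W := FiniteDimensional.proper_real W
  set b : Set W := Metric.ball 0 1 with hb
  have hbm : MeasurableSet b := measurableSet_ball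
  set ρ := (ν.restrict b).prod Γ with hρ
  have : IsFiniteMeasure (ν.restrict b) := ⟨by simpa using measure_ball_lt_top⟩
  have hm0 : ν b ≠ 0 := (Metric.measure_ball_pos ν 0 one_pos).ne'
  have hmt : ν b ≠ ⊤ := measure_ball_lt_top.ne
  have hlow : p * ν b ≤ ρ D := by
    rw [hρ, Measure.prod_apply hD]
    calc p * ν b = ∫⁻ _, p ∂ν.restrict b := by simp
      _ ≤ _ := lintegral_mono fun w => hp w
  have hback : ∀ ε : ℝ, Measurable fun z : W × Ξ => z.1 - ε • h z.2 := fun ε =>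
    measurable_fst.sub ((hh.comp measurable_snd).const_smul ε)
  have hforth : ∀ ε : ℝ, Measurable fun z : W × Ξ => (z.1 + ε • h z.2, z.2) := fun ε =>
    (measurable_fst.add ((hh.comp measurable_snd).const_smul ε)).prodMk measurable_snd
  have hDm : ∀ ε : ℝ, MeasurableSet {z : W × Ξ | (z.1 + ε • h z.2, z.2) ∈ D} := fun ε =>
    hforth ε hD
  -- The pairs for which the translation leaves the ball; their measure tends to `0` with `ε`.
  let U : ℝ → Set (W × Ξ) := fun ε => {z | z.1 - ε • h z.2 ∈ b}ᶜ
  have hUm : ∀ ε, MeasurableSet (U ε) := fun ε => (hback ε hbm).compl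
  have hup : ∀ ε : ℝ, 0 < ε → ρ D ≤ ρ (U ε) + q * ν b := by
    intro ε hε
    -- Outside `U ε` the point `w - ε • h x` lies in the ball and can be taken as the new variable.
    have hstep : ρ (D \ U ε) ≤ ρ {z | (z.1 + ε • h z.2, z.2) ∈ D} := by
      rw [hρ, Measure.prod_apply_symm (hD.diff (hUm ε)), Measure.prod_apply_symm (hDm ε)]
      refine lintegral_mono fun x => ?_
      calc ν.restrict b ((fun w => (w, x)) ⁻¹' (D \ U ε))
          ≤ ν ((fun w => (w, x)) ⁻¹' (D \ U ε)) := Measure.restrict_apply_le _ _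
        _ = ν ((fun w => w + ε • h x) ⁻¹' ((fun w => (w, x)) ⁻¹' (D \ U ε))) :=
          (measure_preimage_add_right ν _ _).symm
        _ ≤ ν.restrict b ((fun w => (w, x)) ⁻¹' {z | (z.1 + ε • h z.2, z.2) ∈ D}) := by
          rw [Measure.restrict_apply' hbm]
          refine measure_mono fun w hw => ⟨hw.1, ?_⟩
          simpa [U] using hw.2
    have hstep2 : ρ {z | (z.1 + ε • h z.2, z.2) ∈ D} ≤ q * ν b := by
      rw [hρ, Measure.prod_apply (hDm ε)]
      calc _ ≤ ∫⁻ _, q ∂ν.restrict b := lintegral_mono fun w => hq w ε hε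
        _ = q * ν b := by simp
    calc ρ D ≤ ρ (D ∩ U ε) + ρ (D \ U ε) := measure_le_inter_add_sdiff _ _ _
      _ ≤ ρ (U ε) + q * ν b :=
        add_le_add (measure_mono Set.inter_subset_right) (hstep.trans hstep2)
  have hlim : Filter.Tendsto (fun k : ℕ => ρ (U (1 / ((k : ℝ) + 1)))) Filter.atTop (nhds 0) := by
    rw [← measure_empty (μ := ρ)]
    refine tendsto_measure_of_ae_tendsto_indicator_of_isFiniteMeasure _ MeasurableSet.empty
      (fun k => hUm _) ?_
    have hmem : ∀ᵐ z ∂ρ, z.1 ∈ b :=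
      Measure.quasiMeasurePreserving_fst.ae (ae_restrict_mem hbm)
    filter_upwards [hmem] with z hz
    have ht : Filter.Tendsto (fun k : ℕ => z.1 - (1 / ((k : ℝ) + 1)) • h z.2) Filter.atTop
        (nhds z.1) := by
      simpa using (tendsto_one_div_add_atTop_nhds_zero_nat (𝕜 := ℝ)).smul_const (h z.2)
        |>.const_sub z.1
    filter_upwards [ht (Metric.isOpen_ball.mem_nhds hz)] with k hk
    exact iff_of_false (fun hU => hU hk) (Set.notMem_empty z)
  have hfinal : p * ν b ≤ 0 + q * ν b :=
    ge_of_tendsto' (hlim.add_const (q * ν b)) fun k => hlow.trans (hup _ (by positivity))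
  rw [zero_add, ENNReal.mul_le_mul_iff_left hm0 hmt] at hfinal
  exact hfinal.not_gt hqp

/-! ### Absorbing the noise into the weights -/

/-- For samples `x` with invertible block `N`, the coefficients `N⁻¹ g`, placed in the positions
`σ k`, where `g` lists the coordinates of the samples at `i₀`. For a singular block `N⁻¹ = 0`, and
the value is `0`. -/
noncomputable def noiseShift {n d : ℕ} (σ : Fin n → Fin d) (i₀ : Fin d)
    (x : Fin n → EuclideanSpace ℝ (Fin d)) : Fin d → ℝ :=
  ∑ k, ((sampleBlock σ x)⁻¹.mulVec fun i => x i i₀) k • Pi.single (σ k) (1 : ℝ)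

theorem measurable_noiseShift {n d : ℕ} (σ : Fin n → Fin d) (i₀ : Fin d) :
    Measurable (noiseShift σ i₀) := by
  have hinv : ∀ k i, Measurable fun x => (sampleBlock σ x)⁻¹ k i := by
    intro k i
    simp only [Matrix.inv_def, Ring.inverse_eq_inv', Matrix.smul_apply, smul_eq_mul]
    refine (continuous_sampleBlock σ).matrix_det.measurable.inv.mul ?_
    exact ((continuous_sampleBlock σ).matrix_adjugate.matrix_elem k i).measurable
  refine measurable_pi_lambda _ fun j => ?_
  simp only [noiseShift, Finset.sum_apply, Pi.smul_apply, smul_eq_mul, Matrix.mulVec, dotProduct]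
  refine Finset.measurable_sum _ fun k _ => Measurable.mul_const ?_ _
  refine Finset.measurable_sum _ fun i _ => (hinv k i).mul ?_
  fun_prop

theorem sum_noiseShift_mul {n d : ℕ} {σ : Fin n → Fin d} {i₀ : Fin d}
    {x : Fin n → EuclideanSpace ℝ (Fin d)} (hx : (sampleBlock σ x).det ≠ 0) (i : Fin n) :
    ∑ j, noiseShift σ i₀ x j * x i j = x i i₀ := by
  have hmul : (sampleBlock σ x).mulVec ((sampleBlock σ x)⁻¹.mulVec fun i => x i i₀) =
      fun i => x i i₀ := by
    rw [Matrix.mulVec_mulVec, Matrix.mul_nonsing_inv _ (isUnit_iff_ne_zero.2 hx),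
      Matrix.one_mulVec]
  rw [← congrFun hmul i]
  simp only [noiseShift, Finset.sum_apply, Pi.smul_apply, smul_eq_mul, Finset.sum_mul]
  rw [Finset.sum_comm]
  conv_rhs => rw [Matrix.mulVec, dotProduct]
  refine Finset.sum_congr rfl fun k _ => ?_
  simp [Pi.single_apply, sampleBlock, mul_comm]

theorem noiseShift_apply_eq_zero {n d : ℕ} {σ : Fin n → Fin d} {i₀ j : Fin d}
    (hj : ∀ k, σ k ≠ j) (x : Fin n → EuclideanSpace ℝ (Fin d)) : noiseShift σ i₀ x j = 0 := by
  simp [noiseShift, fun k => (hj k).symm]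

theorem continuous_loadingMatrix_apply {Z : Type*} [TopologicalSpace Z] {d : ℕ} (hd : 2 ≤ d)
    (ε : ℝ) {f : Z → Fin d → ℝ} {g : Z → EuclideanSpace ℝ (Fin d)} (hf : Continuous f)
    (hg : Continuous g) :
    Continuous fun z =>
      Matrix.toEuclideanCLM (n := Fin d) (𝕜 := ℝ) (loadingMatrix hd (f z) ε) (g z) := by
  have : Continuous fun z => WithLp.toLp 2 ((loadingMatrix hd (f z) ε).mulVec (g z).ofLp) := by
    refine (PiLp.continuous_toLp 2 _).comp (Continuous.matrix_mulVec ?_ ?_)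
    · refine continuous_matrix fun i j => ?_
      simp only [loadingMatrix, Matrix.of_apply]
      split_ifs <;> fun_prop
    · fun_prop
  exact this

theorem sum_masked_noiseShift_mul {n d : ℕ} (hd : 2 ≤ d) {σ : Fin n → Fin d}
    (hσ0 : ∀ k, σ k ≠ Fin.castLE hd 0) (hσ1 : ∀ k, σ k ≠ Fin.castLE hd 1)
    {x : Fin n → EuclideanSpace ℝ (Fin d)} (hx : (sampleBlock σ x).det ≠ 0) (i : Fin n) :
    ∑ j, (if j = Fin.castLE hd 0 ∨ j = Fin.castLE hd 1 then 0
      else noiseShift σ (Fin.castLE hd 0) x j) * x i j = x i (Fin.castLE hd 0) := by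
  rw [← sum_noiseShift_mul hx i]
  refine Finset.sum_congr rfl fun j _ => ?_
  split_ifs with hj
  · rcases hj with rfl | rfl
    · rw [noiseShift_apply_eq_zero hσ0]
    · rw [noiseShift_apply_eq_zero hσ1]
  · rfl

/-! ### Impossibility of estimating the rank -/

/-- The law of the samples `A^{1/2} X_i` of the model `A = B Bᵀ` is that of the vectors `B X_i`. -/
theorem measure_sqrtMap_modelCov {Ω : Type*} [MeasurableSpace Ω] {P : Measure Ω}
    [IsProbabilityMeasure P] {n d : ℕ} (hd : 2 ≤ d) {X : Fin n → Ω → EuclideanSpace ℝ (Fin d)}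
    (hX : ∀ i, HasLaw (X i) (stdGaussian (EuclideanSpace ℝ (Fin d))) P)
    (hind : iIndepFun X P) (w : Fin d → ℝ) (ε : ℝ) {G : Set (Fin n → EuclideanSpace ℝ (Fin d))}
    (hG : MeasurableSet G) :
    P {ω | (fun i => sqrtMap (modelCov hd w ε) (X i ω)) ∈ G} =
      Measure.pi (fun _ : Fin n => stdGaussian (EuclideanSpace ℝ (Fin d)))
        {x | (fun i => Matrix.toEuclideanCLM (n := Fin d) (𝕜 := ℝ)
          (loadingMatrix hd w ε) (x i)) ∈ G} := by
  have hlaw : P.map (fun ω i => X i ω) =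
      Measure.pi (fun _ : Fin n => stdGaussian (EuclideanSpace ℝ (Fin d))) := by
    rw [(iIndepFun_iff_map_fun_eq_pi_map fun i => (hX i).aemeasurable).1 hind]
    simp only [(hX _).map_eq]
  have hT : ∀ T : EuclideanSpace ℝ (Fin d) →L[ℝ] EuclideanSpace ℝ (Fin d),
      (Measure.pi (fun _ : Fin n => stdGaussian (EuclideanSpace ℝ (Fin d)))).map
        (fun x i => T (x i)) =
      Measure.pi (fun _ : Fin n => (stdGaussian (EuclideanSpace ℝ (Fin d))).map T) := by
    intro T
    have : IsProbabilityMeasure ((stdGaussian (EuclideanSpace ℝ (Fin d))).map T) :=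
      Measure.isProbabilityMeasure_map (by fun_prop)
    exact Measure.pi_map_pi fun _ => by fun_prop
  have hm : ∀ T : EuclideanSpace ℝ (Fin d) →L[ℝ] EuclideanSpace ℝ (Fin d),
      Measurable fun (x : Fin n → EuclideanSpace ℝ (Fin d)) i => T (x i) := by
    intro T; fun_prop
  calc P {ω | (fun i => sqrtMap (modelCov hd w ε) (X i ω)) ∈ G}
      = P.map (fun ω i => X i ω) {x | (fun i => sqrtMap (modelCov hd w ε) (x i)) ∈ G} :=
        (Measure.map_apply_of_aemeasurable
          (aemeasurable_pi_lambda _ fun i => (hX i).aemeasurable) (hm _ hG)).symm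
    _ = (Measure.pi (fun _ : Fin n => stdGaussian (EuclideanSpace ℝ (Fin d)))).map
          (fun x i => sqrtMap (modelCov hd w ε) (x i)) G := by
        rw [hlaw, Measure.map_apply (hm _) hG]; rfl
    _ = (Measure.pi (fun _ : Fin n => stdGaussian (EuclideanSpace ℝ (Fin d)))).map
          (fun x i => Matrix.toEuclideanCLM (n := Fin d) (𝕜 := ℝ) (loadingMatrix hd w ε) (x i))
          G := by
        rw [hT, hT, modelCov, map_sqrtMap_stdGaussian]
    _ = _ := by rw [Measure.map_apply (hm _) hG]; rfl

theorem mainTheorem1 {Ω : Type*} [MeasurableSpace Ω] (P : Measure Ω) [IsProbabilityMeasure P]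
    (n d : ℕ) (hd : 2 ≤ d) (hn : (n : ℝ) < (d : ℝ) / 3)
    (X : Fin n → Ω → EuclideanSpace ℝ (Fin d))
    (hX : ∀ i, HasLaw (X i) (stdGaussian (EuclideanSpace ℝ (Fin d))) P)
    (hind : iIndepFun X P) :
    ¬ ∃ F : (Fin n → EuclideanSpace ℝ (Fin d)) → Fin 3, Measurable F ∧
      ∀ A : Matrix (Fin d) (Fin d) ℝ, A.PosSemidef →
        P.real {ω | (F (fun i => sqrtMap A (X i ω)) : ℕ) = (covE hd A).rank} > 0.9 := by
  rintro ⟨F, hF, hprob⟩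
  have hnd : n + 2 ≤ d := by
    have h3 : 3 * n < d := by
      have : (3 : ℝ) * n < d := by linarith
      exact_mod_cast this
    omega
  -- The `n` coordinates following the first two serve to absorb the noise.
  let σ : Fin n → Fin d := fun k => ⟨k + 2, by omega⟩
  have hσ : Function.Injective σ := fun k l hkl => by
    simpa [σ, Fin.ext_iff] using hkl
  have hσ0 : ∀ k, σ k ≠ Fin.castLE hd 0 := fun k => by simp [σ, Fin.ext_iff]
  have hσ1 : ∀ k, σ k ≠ Fin.castLE hd 1 := fun k => by simp [σ, Fin.ext_iff]
  set Γ := Measure.pi (fun _ : Fin n => stdGaussian (EuclideanSpace ℝ (Fin d))) with hΓ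
  set G : Set (Fin n → EuclideanSpace ℝ (Fin d)) := F ⁻¹' {0} with hGdef
  have hG : MeasurableSet G := hF (measurableSet_singleton 0)
  let D : Set ((Fin d → ℝ) × (Fin n → EuclideanSpace ℝ (Fin d))) :=
    {z | (fun i => Matrix.toEuclideanCLM (n := Fin d) (𝕜 := ℝ)
      (loadingMatrix hd z.1 0) (z.2 i)) ∈ G}
  have hD : MeasurableSet D := by
    have hcont : Continuous fun (z : (Fin d → ℝ) × (Fin n → EuclideanSpace ℝ (Fin d)))
        (i : Fin n) => Matrix.toEuclideanCLM (n := Fin d) (𝕜 := ℝ)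
          (loadingMatrix hd z.1 0) (z.2 i) :=
      continuous_pi fun i => continuous_loadingMatrix_apply hd 0 continuous_fst (by fun_prop)
    exact hcont.measurable hG
  refine not_separated_of_small_translation (volume : Measure (Fin d → ℝ)) Γ
    (measurable_noiseShift σ (Fin.castLE hd 0)) hD
    (p := ENNReal.ofReal 0.9) (q := ENNReal.ofReal 0.1)
    ((ENNReal.ofReal_lt_ofReal_iff (by norm_num)).2 (by norm_num)) (fun w => ?_) fun w ε hε => ?_
  · have h := hprob _ (posSemidef_modelCov hd w 0)
    rw [rank_covE_modelCov_zero] at h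
    have hset : {ω | (F (fun i => sqrtMap (modelCov hd w 0) (X i ω)) : ℕ) = 0} =
        {ω | (fun i => sqrtMap (modelCov hd w 0) (X i ω)) ∈ G} := by
      ext ω; exact Fin.val_eq_zero_iff
    rw [hset] at h
    change _ ≤ Γ {x | (fun i => Matrix.toEuclideanCLM (n := Fin d) (𝕜 := ℝ)
      (loadingMatrix hd w 0) (x i)) ∈ G}
    rw [hΓ, ← measure_sqrtMap_modelCov hd hX hind w 0 hG, ← ofReal_measureReal]
    exact ENNReal.ofReal_le_ofReal h.le
  · have h := hprob _ (posSemidef_modelCov hd w ε)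
    have hshift : Γ {x | (w + ε • noiseShift σ (Fin.castLE hd 0) x, x) ∈ D} =
        P {ω | (fun i => sqrtMap (modelCov hd w ε) (X i ω)) ∈ G} := by
      rw [measure_sqrtMap_modelCov hd hX hind w ε hG]
      refine measure_congr ?_
      filter_upwards [ae_det_sampleBlock_ne_zero hσ] with x hx
      have : (fun i => Matrix.toEuclideanCLM (n := Fin d) (𝕜 := ℝ)
          (loadingMatrix hd w ε) (x i)) = fun i => Matrix.toEuclideanCLM (n := Fin d) (𝕜 := ℝ)
          (loadingMatrix hd (w + ε • noiseShift σ (Fin.castLE hd 0) x) 0) (x i) :=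
        funext fun i => loadingMatrix_apply_eq hd w _ ε (x i)
          (sum_masked_noiseShift_mul hd hσ0 hσ1 hx i)
      apply propext
      change (fun i => Matrix.toEuclideanCLM (n := Fin d) (𝕜 := ℝ)
          (loadingMatrix hd (w + ε • noiseShift σ (Fin.castLE hd 0) x) 0) (x i)) ∈ G ↔
        (fun i => Matrix.toEuclideanCLM (n := Fin d) (𝕜 := ℝ) (loadingMatrix hd w ε) (x i)) ∈ G
      rw [this]
    rw [hshift, ← ofReal_measureReal]
    refine ENNReal.ofReal_le_ofReal ?_
    have hmeas : AEMeasurable (fun ω i => sqrtMap (modelCov hd w ε) (X i ω)) P :=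
      aemeasurable_pi_lambda _ fun i =>
        (sqrtMap (modelCov hd w ε)).continuous.measurable.comp_aemeasurable (hX i).aemeasurable
    -- For `ε > 0` the rank is nonzero, so a correct answer excludes the value `0`.
    have hcompl := probReal_compl_eq_one_sub₀ (μ := P) (hmeas.nullMeasurableSet_preimage hG)
    have hle : P.real {ω | (F (fun i => sqrtMap (modelCov hd w ε) (X i ω)) : ℕ) =
        (covE hd (modelCov hd w ε)).rank} ≤
        P.real ((fun ω i => sqrtMap (modelCov hd w ε) (X i ω)) ⁻¹' G)ᶜ := by
      refine measureReal_mono fun ω hω hmem => rank_covE_modelCov_ne_zero hd w hε ?_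
      rw [← (hω : _ = _)]
      exact congrArg Fin.val (hmem : _ = _)
    rw [hcompl] at hle
    change P.real ((fun ω i => sqrtMap (modelCov hd w ε) (X i ω)) ⁻¹' G) ≤ 0.1
    linarith
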